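/- A \emph{pdf} is an a.e.\ non-negative function with Lebesgue integral one; equalities of functions are understood Lebesgue-almost everywhere. Let $\mathcal{D}_d$ be the set of all pdfs on $\mathbb{R}^d$ supported on the unit cube $[0,1]^d$. A pdf $p$ on $\mathbb{R}^d$ has a \emph{non-negative Lipschitz spectrum} (NL-spectrum) $(w,\ell)$, $w=(w_i)_{i\ge1}$, $\ell=(\ell_i)_{i\ge1}$, if $$p(x_1,\dots,x_d)=\sum_{i=1}^\infty w_i\prod_{j=1}^d p_{i,j}(x_j),$$ where $w_i\ge 0$, $w_1>0$, $\sum_{i=1}^\infty w_i=1$, and for all $i\ge 1$ and $1\le j\le d$ the function $p_{i,j}$ is an $\ell_i$-Lipschitz pdf on $\mathbb{R}$. For a non-negative, non-increasing sequence $W=(W_i)_{i\ge1}$ converging to $0$ and a non-negative, non-decreasing sequence $L=(L_i)_{i\ge1}$, the \emph{NL-class} $\mathfrak{V}(W,L)$ is the set of all pdfs that have an NL-spectrum $(w,\ell)$ with $\ell_m\le L_m$ and $\sum_{i=m+1}^\infty w_i\le W_m$ for all $m\ge 1$. \textbf{Theorem.} Let $d,b,k,n\ge 1$ be integers and $0<\delta\le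 1$. There exists an estimator $V_n$, that is, a (jointly measurable) function of the sample $X_1,\dots,X_n\in\mathbb{R}^d$ and the evaluation point with $V_n(X_1,\dots,X_n)\in\mathcal{D}_d$ for every sample, such that for all sequences $W,L$ as above and every density $p\in\mathcal{D}_d\cap\mathfrak{V}(W,L)$, if $X_1,\dots,X_n$ are independent with density $p$, then $$P\left(\|p-V_n\|_1>\frac{\sqrt3\,d}{2b}L_k+6W_k+7\sqrt{\frac{2bdk\log(4bdkn)}{n}}+7\sqrt{\frac{\log(3/\delta)}{2n}}\right)<\delta,$$ where $\|\cdot\|_1$ is the $L^1$ norm with respect to Lebesgue measure. -/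

import Mathlib

open MeasureTheory ProbabilityTheory Filter Topology
open scoped NNReal

/-- A probability density function with respect to the reference (Lebesgue) measure:
an a.e. non-negative integrable function with integral one. -/
def IsPdf {α : Type*} [MeasureSpace α] (p : α → ℝ) : Prop :=
  Integrable p volume ∧ 0 ≤ᵐ[volume] p ∧ ∫ x, p x = 1

/-- The set of all pdfs on `ℝ^d` supported on the unit cube `[0,1]^d`
(they vanish almost everywhere outside the cube). -/
def cubePdfs (d : ℕ) : Set ((Fin d → ℝ) → ℝ) :=
  {p | IsPdf p ∧ ∀ᵐ x : Fin d → ℝ, x ∉ Set.Icc (0 : Fin d → ℝ) 1 → p x = 0}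

/-- `p` has non-negative Lipschitz spectrum `(w, L)`: almost everywhere
`p (x_1, …, x_d) = ∑ i, w_i * ∏ j, q_{i,j} (x_j)`, where the weights are non-negative,
sum to one, `w_1 > 0`, and every `q_{i,j}` is an `L_i`-Lipschitz pdf on the real line.
Sequences are indexed by the positive integers. -/
def HasNLSpectrum {d : ℕ} (p : (Fin d → ℝ) → ℝ) (w : ℕ+ → ℝ) (L : ℕ+ → ℝ≥0) : Prop :=
  (∀ i, 0 ≤ w i) ∧ 0 < w 1 ∧ HasSum w 1 ∧
    ∃ q : ℕ+ → Fin d → ℝ → ℝ,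
      (∀ i j, IsPdf (q i j) ∧ LipschitzWith (L i) (q i j)) ∧
      ∀ᵐ x : Fin d → ℝ, HasSum (fun i => w i * ∏ j, q i j (x j)) (p x)

/-- The parameters of an NL-class: `W` is non-negative, non-increasing and tends to `0`,
and `L` is non-negative and non-decreasing. -/
def IsNLParam (W L : ℕ+ → ℝ) : Prop :=
  (∀ i, 0 ≤ W i) ∧ Antitone W ∧ Tendsto W atTop (𝓝 0) ∧ (∀ i, 0 ≤ L i) ∧ Monotone L

/-- The NL-class of `(W, L)` in dimension `d`: all pdfs that have a non-negative Lipschitz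
spectrum `(w, l)` with `l_m ≤ L_m` and `∑_{i > m} w_i ≤ W_m` for all `m`. -/
def nlClass (d : ℕ) (W L : ℕ+ → ℝ) : Set ((Fin d → ℝ) → ℝ) :=
  {p | IsPdf p ∧ ∃ (w : ℕ+ → ℝ) (l : ℕ+ → ℝ≥0), HasNLSpectrum p w l ∧
    ∀ m : ℕ+, (l m : ℝ) ≤ L m ∧ ∑' i : Set.Ioi m, w i ≤ W m}

/-- An estimator of densities on the unit cube from `n` observations in `ℝ^d`: a function of
the observations and of the evaluation point that is jointly measurable and whose value at
every sample is a pdf supported on the cube. -/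
def IsCubeEstimator {n d : ℕ} (V : (Fin n → Fin d → ℝ) → (Fin d → ℝ) → ℝ) : Prop :=
  Measurable (Function.uncurry V) ∧ ∀ x, V x ∈ cubePdfs d

/-- Under `P`, the random vectors `X_1, …, X_n` are independent and each of them has
density `p`. -/
def IsIIDSample {Ω : Type*} [MeasurableSpace Ω] (P : Measure Ω) {n d : ℕ}
    (X : Fin n → Ω → Fin d → ℝ) (p : (Fin d → ℝ) → ℝ) : Prop :=
  iIndepFun X P ∧
    ∀ i, HasLaw (X i) ((volume : Measure (Fin d → ℝ)).withDensity
      fun x => ENNReal.ofReal (p x)) P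

/-! The estimator is Yatracos' minimum distance selector over a finite net of mixtures of `k`
products of histograms with `b` bins, whose weights and bin masses lie on a grid. The net depends
only on `d`, `b`, `k`, `n`, so one estimator serves all `W`, `L` and `p`.

If the empirical frequencies of all sets `{g j < g i}` are within `t` of their probabilities, the
selected density has `L¹` error at most three times that of any member of the net, plus `4 t`
(`exists_minimum_distance_selector`). Hoeffding's inequality and a union bound over pairs supply
`t`; it depends on the net only through the logarithm of its size, of order `b d k log (4 b d k n)`.

The net approximates `p` well (`exists_grid_histogramMixture_close`): truncating the spectrum at `k`
and renormalising costs `2 W k`, replacing each factor by its histogram costs `L k / (√12 b)` per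
coordinate, and rounding to the grid costs `O(1/n)`, absorbed by the stochastic term. -/

/-! ### Measurable choice of a minimiser -/

theorem exists_measurable_argmin {X ι : Type*} [MeasurableSpace X] [Finite ι] [Nonempty ι]
    (s : ι → X → ℝ) (hs : ∀ i, Measurable (s i)) :
    ∃ sel : X → ι, (∀ i, MeasurableSet {x | sel x = i}) ∧ ∀ x j, s (sel x) x ≤ s j x := by
  classical
  obtain ⟨m, ⟨e⟩⟩ := Finite.exists_equiv_fin ι
  -- Ties are broken by the least index in a fixed enumeration, which makes the choice measurable.
  let p : X → ℕ → Prop := fun x N => ∃ h : N < m, ∀ j, s (e.symm ⟨N, h⟩) x ≤ s j x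
  have hp : ∀ x, ∃ N, p x N := by
    intro x
    obtain ⟨i, hi⟩ := Finite.exists_min fun i => s i x
    exact ⟨e i, (e i).2, by simpa using hi⟩
  have hm : ∀ N, MeasurableSet {x | p x N} := by
    intro N
    by_cases h : N < m
    · have : {x | p x N} = ⋂ j, {x | s (e.symm ⟨N, h⟩) x ≤ s j x} := by
        ext x; simp [p, h]
      rw [this]
      exact MeasurableSet.iInter fun j => measurableSet_le (hs _) (hs j)
    · simp [p, h]
  have hf := measurable_find hp hm
  refine ⟨fun x => e.symm ⟨Nat.find (hp x), (Nat.find_spec (hp x)).1⟩, fun i => ?_,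
    fun x => (Nat.find_spec (hp x)).2⟩
  have : {x | e.symm ⟨Nat.find (hp x), (Nat.find_spec (hp x)).1⟩ = i}
      = (fun x => Nat.find (hp x)) ⁻¹' {(e i : ℕ)} := by
    ext x
    simp [Equiv.symm_apply_eq, Fin.ext_iff]
  rw [this]
  exact hf (measurableSet_singleton _)

/-! ### `L¹` distances and minimum distance selection -/

section L1

variable {α : Type*} [MeasureSpace α]

/-- Since `f - g` has integral zero, its integrals over `A` and `Aᶜ` are opposite, and each is
bounded by its own share of the `L¹` norm. -/
theorem IsPdf.abs_setIntegral_sub_le {f g : α → ℝ} (hf : IsPdf f) (hg : IsPdf g) {A : Set α}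
    (hA : MeasurableSet A) :
    2 * |(∫ x in A, f x) - ∫ x in A, g x| ≤ ∫ x, |f x - g x| := by
  have hu : Integrable (fun x => f x - g x) := hf.1.sub hg.1
  have h0 : ∫ x, (f x - g x) = 0 := by
    rw [integral_sub hf.1 hg.1, hf.2.2, hg.2.2, sub_self]
  have h1 := integral_add_compl hA hu
  have h2 := integral_add_compl hA hu.abs
  have h3 := abs_integral_le_integral_abs (f := fun x => f x - g x) (μ := volume.restrict A)
  have h4 := abs_integral_le_integral_abs (f := fun x => f x - g x) (μ := volume.restrict Aᶜ)
  rw [← integral_sub hf.1.integrableOn hg.1.integrableOn]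
  have h5 : |∫ x in Aᶜ, (f x - g x)| = |∫ x in A, (f x - g x)| := by
    rw [← abs_neg]; congr 1; linarith
  linarith

/-- Scheffé's identity: the set where `f` exceeds `g` attains equality in the preceding bound, so
the Yatracos sets detect all `L¹` distances within the family. -/
theorem IsPdf.integral_abs_sub_eq {f g : α → ℝ} (hf : IsPdf f) (hg : IsPdf g)
    (hA : MeasurableSet {x | g x < f x}) :
    ∫ x, |f x - g x| = 2 * ((∫ x in {x | g x < f x}, f x) - ∫ x in {x | g x < f x}, g x) := by
  have hu : Integrable (fun x => f x - g x) := hf.1.sub hg.1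
  have h0 : ∫ x, (f x - g x) = 0 := by
    rw [integral_sub hf.1 hg.1, hf.2.2, hg.2.2, sub_self]
  have h1 := integral_add_compl hA hu
  have h2 := integral_add_compl hA hu.abs
  have h3 : ∫ x in {x | g x < f x}, |f x - g x| = ∫ x in {x | g x < f x}, (f x - g x) :=
    setIntegral_congr_fun hA fun x hx => abs_of_pos (sub_pos.2 hx)
  have h4 : ∫ x in {x | g x < f x}ᶜ, |f x - g x| = ∫ x in {x | g x < f x}ᶜ, -(f x - g x) :=
    setIntegral_congr_fun hA.compl fun x hx => abs_of_nonpos (by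
      simpa using hx)
  rw [integral_neg] at h4
  rw [← integral_sub hf.1.integrableOn hg.1.integrableOn]
  linarith

theorem integral_abs_sub_triangle {f g h : α → ℝ} (hf : Integrable f) (hg : Integrable g)
    (hh : Integrable h) :
    ∫ x, |f x - h x| ≤ (∫ x, |f x - g x|) + ∫ x, |g x - h x| := by
  have h1 : Integrable fun x => |f x - g x| := (hf.sub hg).abs
  have h2 : Integrable fun x => |g x - h x| := (hg.sub hh).abs
  rw [← integral_add h1 h2]
  exact integral_mono (hf.sub hh).abs (h1.add h2) fun x => abs_sub_le _ _ _

/-- The fraction of the sample points that lie in `A`. -/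
noncomputable def empiricalFreq {α : Type*} {n : ℕ} (x : Fin n → α) (A : Set α) : ℝ :=
  (∑ m, A.indicator (fun _ => (1 : ℝ)) (x m)) / n

theorem measurable_empiricalFreq {n : ℕ} {A : Set α} (hA : MeasurableSet A) :
    Measurable fun x : Fin n → α => empiricalFreq x A := by
  unfold empiricalFreq
  refine Measurable.div_const (Finset.measurable_fun_sum _ fun m _ => ?_) _
  exact (measurable_const.indicator hA).comp (measurable_pi_apply m)

/-- The minimum distance estimate over the Yatracos class of a finite family of densities. -/
theorem exists_minimum_distance_selector {ι : Type*} [Fintype ι] [Nonempty ι] (n : ℕ)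
    (g : ι → α → ℝ) (hg : ∀ i, IsPdf (g i)) (hgm : ∀ i, Measurable (g i)) :
    ∃ sel : (Fin n → α) → ι, (∀ i, MeasurableSet {x | sel x = i}) ∧
      ∀ (p : α → ℝ), IsPdf p → ∀ (x : Fin n → α) (t : ℝ),
        (∀ i j, |empiricalFreq x {y | g j y < g i y} - ∫ y in {y | g j y < g i y}, p y| ≤ t) →
        ∀ i, ∫ y, |p y - g (sel x) y| ≤ 3 * (∫ y, |p y - g i y|) + 4 * t := by
  have hA : ∀ i j, MeasurableSet {y | g j y < g i y} := fun i j =>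
    measurableSet_lt (hgm j) (hgm i)
  let D : ι → ι × ι → (Fin n → α) → ℝ := fun l q x =>
    |empiricalFreq x {y | g q.2 y < g q.1 y} - ∫ y in {y | g q.2 y < g q.1 y}, g l y|
  -- The score of `g l` is its largest discrepancy from the empirical measure over the Yatracos
  -- sets.
  let s : ι → (Fin n → α) → ℝ := fun l x => ⨆ q, D l q x
  have hD : ∀ l q x, D l q x ≤ s l x := fun l q x =>
    le_ciSup (f := fun q => D l q x) (Set.finite_range _).bddAbove q
  have hs : ∀ l, Measurable (s l) := by
    intro l
    refine Measurable.iSup fun q => ?_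
    have := (measurable_empiricalFreq (n := n) (hA q.1 q.2)).sub_const
      (∫ y in {y | g q.2 y < g q.1 y}, g l y)
    exact this.abs
  obtain ⟨sel, hsel, hmin⟩ := exists_measurable_argmin s hs
  refine ⟨sel, hsel, fun p hp x t ht i => ?_⟩
  set l := sel x
  have h1 : s i x ≤ t + (∫ y, |p y - g i y|) / 2 := by
    refine ciSup_le fun q => ?_
    have h2 := hp.abs_setIntegral_sub_le (hg i) (hA q.1 q.2)
    have h3 := ht q.1 q.2
    have h4 := abs_sub_le (empiricalFreq x {y | g q.2 y < g q.1 y})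
      (∫ y in {y | g q.2 y < g q.1 y}, p y) (∫ y in {y | g q.2 y < g q.1 y}, g i y)
    simp only [D]
    linarith
  -- On the set for `(l, i)` both `g l` and `g i` are within `t + ‖p - g i‖₁ / 2` of the empirical
  -- frequency. Scheffé's identity then gives `‖g l - g i‖₁ ≤ 4 t + 2 ‖p - g i‖₁`, and the triangle
  -- inequality adds the third `‖p - g i‖₁`.
  have h2 := (hg l).integral_abs_sub_eq (hg i) (hA l i)
  have h3 := abs_le.1 ((hD l (l, i) x).trans ((hmin x i).trans h1))
  have h4 := abs_le.1 ((hD i (l, i) x).trans h1)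
  have h5 := integral_abs_sub_triangle hp.1 (hg i).1 (hg l).1
  have h6 : ∫ y, |g i y - g l y| = ∫ y, |g l y - g i y| := by
    simp_rw [abs_sub_comm]
  dsimp only at h3 h4
  linarith

end L1

/-! ### Concentration of empirical frequencies -/

section Hoeffding

variable {α : Type*} [MeasureSpace α]

theorem measureReal_withDensity_ofReal_eq {p : α → ℝ} (hp : IsPdf p) {A : Set α}
    (hA : MeasurableSet A) :
    ((volume : Measure α).withDensity fun x => ENNReal.ofReal (p x)).real A = ∫ x in A, p x := by
  rw [measureReal_def, withDensity_apply _ hA,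
    ← ofReal_integral_eq_lintegral_ofReal hp.1.integrableOn (ae_restrict_of_ae hp.2.1),
    ENNReal.toReal_ofReal (integral_nonneg_of_ae (ae_restrict_of_ae hp.2.1))]

theorem measure_empiricalFreq_sub_ge_le {Ω : Type*} [MeasurableSpace Ω] {P : Measure Ω}
    [IsProbabilityMeasure P] {n : ℕ} (hn : 1 ≤ n) {X : Fin n → Ω → α} {p : α → ℝ} (hp : IsPdf p)
    (hind : iIndepFun X P)
    (hX : ∀ i, HasLaw (X i) ((volume : Measure α).withDensity fun x => ENNReal.ofReal (p x)) P)
    {A : Set α} (hA : MeasurableSet A) {t : ℝ} (ht : 0 ≤ t) :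
    P.real {ω | t ≤ |empiricalFreq (fun i => X i ω) A - ∫ y in A, p y|}
      ≤ 2 * Real.exp (-(2 * n * t ^ 2)) := by
  have hn' : (0 : ℝ) < n := by exact_mod_cast hn
  set a := ∫ y in A, p y with ha
  let φ : α → ℝ := A.indicator fun _ => 1
  have hφ : Measurable φ := measurable_const.indicator hA
  have hint : ∀ i, ∫ ω, φ (X i ω) ∂P = a := by
    intro i
    have := (hX i).integral_comp (f := φ) hφ.aestronglyMeasurable
    simp only [Function.comp_def] at this
    rw [this, integral_indicator_const _ hA, measureReal_withDensity_ofReal_eq hp hA]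
    simp [ha]
  -- Hoeffding's lemma for values in `[0, 1]`: the variance proxy is `1 / 4`, whence the exponent `2
  -- n t²` in each of the two tails.
  let c : ℝ≥0 := (‖(1 : ℝ) - 0‖₊ / 2) ^ 2
  have hc : (c : ℝ) = 1 / 4 := by simp [c]; norm_num
  have hsub : ∀ i, HasSubgaussianMGF (fun ω => φ (X i ω) - a) c P := by
    intro i
    have := hasSubgaussianMGF_of_mem_Icc (μ := P) (X := fun ω => φ (X i ω)) (a := 0) (b := 1)
      (hφ.comp_aemeasurable (hX i).aemeasurable) (Eventually.of_forall fun ω => by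
        by_cases h : X i ω ∈ A <;> simp [φ, h])
    rwa [hint i] at this
  have hind1 : iIndepFun (fun i ω => φ (X i ω) - a) P :=
    hind.comp (fun _ y => φ y - a) fun _ => hφ.sub_const a
  have hind2 : iIndepFun (fun i ω => -(φ (X i ω) - a)) P :=
    hind.comp (fun _ y => -(φ y - a)) fun _ => (hφ.sub_const a).neg
  have hnt : (0 : ℝ) ≤ n * t := by positivity
  have h1 := HasSubgaussianMGF.measure_sum_ge_le_of_iIndepFun hind1 (s := Finset.univ)
    (c := fun _ => c) (fun i _ => hsub i) hnt
  have h2 := HasSubgaussianMGF.measure_sum_ge_le_of_iIndepFun hind2 (s := Finset.univ)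
    (c := fun _ => c) (fun i _ => (hsub i).neg) hnt
  have he : -((n : ℝ) * t) ^ 2 / (2 * ((∑ _i : Fin n, c : ℝ≥0) : ℝ)) = -(2 * n * t ^ 2) := by
    simp [hc]; field_simp; ring
  rw [he] at h1 h2
  have key : ∀ ω, (empiricalFreq (fun i => X i ω) A - a) * n = ∑ i, (φ (X i ω) - a) := by
    intro ω
    simp only [empiricalFreq, φ, Finset.sum_sub_distrib, Finset.sum_const, Finset.card_univ,
      Fintype.card_fin, nsmul_eq_mul]
    field_simp
  have hsubset : {ω | t ≤ |empiricalFreq (fun i => X i ω) A - a|} ⊆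
      {ω | n * t ≤ ∑ i, (φ (X i ω) - a)} ∪ {ω | n * t ≤ ∑ i, -(φ (X i ω) - a)} := by
    intro ω hω
    rcases le_abs.1 (show t ≤ |_| from hω) with h | h
    · left
      show n * t ≤ _
      rw [← key]; nlinarith
    · right
      show n * t ≤ _
      rw [Finset.sum_neg_distrib, ← key]; nlinarith
  calc _ ≤ _ := measureReal_mono hsubset
    _ ≤ _ := measureReal_union_le _ _
    _ ≤ _ := by linarith

end Hoeffding

/-! ### From the selector to an estimator with a tail bound -/

/-- The minimum distance estimator over a finite family of densities on the cube. -/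
theorem exists_cubeEstimator_of_finite {n d : ℕ} (hn : 1 ≤ n) {ι : Type*} [Fintype ι] [Nonempty ι]
    (g : ι → (Fin d → ℝ) → ℝ) (hg : ∀ i, g i ∈ cubePdfs d) (hgm : ∀ i, Measurable (g i)) :
    ∃ V : (Fin n → Fin d → ℝ) → (Fin d → ℝ) → ℝ, IsCubeEstimator V ∧
      ∀ p : (Fin d → ℝ) → ℝ, IsPdf p → ∀ i, ∀ t : ℝ, 0 ≤ t →
      ∀ (Ω : Type*) [MeasurableSpace Ω] (P : Measure Ω) [IsProbabilityMeasure P]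
        (X : Fin n → Ω → Fin d → ℝ), IsIIDSample P X p →
        P.real {ω | 3 * (∫ y, |p y - g i y|) + 4 * t < ∫ y, |p y - V (fun i => X i ω) y|}
          ≤ Fintype.card ι ^ 2 * (2 * Real.exp (-(2 * n * t ^ 2))) := by
  classical
  obtain ⟨sel, hsel, hmin⟩ := exists_minimum_distance_selector n g (fun i => (hg i).1) hgm
  refine ⟨fun x => g (sel x), ⟨?_, fun x => hg _⟩, ?_⟩
  -- Joint measurability: only finitely many densities can be selected, each on a measurable set of
  -- samples.
  · have : (Function.uncurry fun x => g (sel x)) = fun z : (Fin n → Fin d → ℝ) × (Fin d → ℝ) =>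
        ∑ i, {x | sel x = i}.indicator (fun _ => (1 : ℝ)) z.1 * g i z.2 := by
      ext ⟨x, y⟩
      simp [Function.uncurry, Set.indicator_apply]
    rw [this]
    refine Finset.measurable_fun_sum _ fun i _ => Measurable.mul ?_ ((hgm i).comp measurable_snd)
    exact (measurable_const.indicator (hsel i)).comp measurable_fst
  · intro p hp i t ht Ω _ P _ X hX
    let B : ι × ι → Set Ω := fun q => {ω | t ≤ |empiricalFreq (fun i => X i ω)
      {y | g q.2 y < g q.1 y} - ∫ y in {y | g q.2 y < g q.1 y}, p y|}
    have hsub : {ω | 3 * (∫ y, |p y - g i y|) + 4 * t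
        < ∫ y, |p y - g (sel fun i => X i ω) y|} ⊆ ⋃ q, B q := by
      intro ω hω
      by_contra hcon
      simp only [Set.mem_iUnion, not_exists, B, Set.mem_ofPred_eq, not_le] at hcon
      exact absurd (hmin p hp (fun i => X i ω) t (fun a b => (hcon (a, b)).le) i)
        (not_le.2 hω)
    calc _ ≤ P.real (⋃ q, B q) := measureReal_mono hsub
      _ ≤ ∑ q, P.real (B q) := measureReal_iUnion_fintype_le _
      _ ≤ ∑ q : ι × ι, 2 * Real.exp (-(2 * n * t ^ 2)) :=
        Finset.sum_le_sum fun q _ => measure_empiricalFreq_sub_ge_le hn hp hX.1 hX.2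
          (measurableSet_lt (hgm _) (hgm _)) ht
      _ = _ := by simp [Fintype.card_prod]; ring

/-! ### Rounding probability vectors to a grid -/

section Grid

/-- The probability vector proportional to `a + 1`, for a vector `a` of bounded integers. -/
noncomputable def gridWeight {κ : Type*} [Fintype κ] {M : ℕ} (a : κ → Fin M) (i : κ) : ℝ :=
  ((a i : ℕ) + 1 : ℝ) / ∑ j, ((a j : ℕ) + 1 : ℝ)

theorem gridWeight_mem_stdSimplex {κ : Type*} [Fintype κ] [Nonempty κ] {M : ℕ} (a : κ → Fin M) :
    gridWeight a ∈ stdSimplex ℝ κ := by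
  have h : 0 < ∑ j, ((a j : ℕ) + 1 : ℝ) := Finset.sum_pos (fun _ _ => by positivity) (by simp)
  refine ⟨fun i => by unfold gridWeight; positivity, ?_⟩
  simp only [gridWeight]
  rw [← Finset.sum_div, div_self h.ne']

/-- The integer `⌊N w i⌋ + 1` is within `1` of `N w i`, and the total of these integers is within
`card κ` of `N`. Rounding and renormalising therefore cost at most `card κ / N` each. -/
theorem exists_gridWeight_close {κ : Type*} [Fintype κ] [Nonempty κ] {w : κ → ℝ}
    (hw : w ∈ stdSimplex ℝ κ) {N : ℕ} (hN : 0 < N) :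
    ∃ a : κ → Fin (N + 1), ∑ i, |w i - gridWeight a i| ≤ 2 * Fintype.card κ / N := by
  have hN' : (0 : ℝ) < N := by exact_mod_cast hN
  have hle : ∀ i, w i ≤ 1 := fun i => hw.2 ▸ Finset.single_le_sum (fun j _ => hw.1 j)
    (Finset.mem_univ i)
  have hfl : ∀ i, ⌊N * w i⌋₊ < N + 1 := fun i => by
    have : ⌊(N : ℝ) * w i⌋₊ ≤ N :=
      Nat.floor_le_of_le (by nlinarith [hle i])
    omega
  refine ⟨fun i => ⟨⌊N * w i⌋₊, hfl i⟩, ?_⟩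
  set u : κ → ℝ := fun i => (⌊N * w i⌋₊ : ℝ) + 1 with hu
  set S := ∑ j, u j with hS
  have hupos : ∀ i, 0 < u i := fun i => by simp only [hu]; positivity
  have hSpos : 0 < S := Finset.sum_pos (fun i _ => hupos i) (by simp)
  have h1 : ∀ i, |N * w i - u i| ≤ 1 := fun i => by
    have h2 := Nat.floor_le (mul_nonneg hN'.le (hw.1 i))
    have h3 := Nat.lt_floor_add_one ((N : ℝ) * w i)
    rw [abs_le]; constructor <;> simp only [hu] <;> linarith
  have h2 : ∑ i, |N * w i - u i| ≤ Fintype.card κ := by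
    calc _ ≤ ∑ _i : κ, (1 : ℝ) := Finset.sum_le_sum fun i _ => h1 i
      _ = _ := by simp
  have h3 : |N - S| ≤ Fintype.card κ := by
    have : (N : ℝ) - S = ∑ i, (N * w i - u i) := by
      rw [Finset.sum_sub_distrib, ← Finset.mul_sum, hw.2, mul_one]
    rw [this]
    exact (Finset.abs_sum_le_sum_abs _ _).trans h2
  have h4 : ∀ i, |w i - u i / S| ≤ |N * w i - u i| / N + u i * |N - S| / (S * N) := fun i => by
    have e : w i - u i / S = (N * w i - u i) / N + -(u i * (N - S)) / (S * N) := by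
      field_simp; ring
    rw [e]
    refine (abs_add_le _ _).trans (le_of_eq ?_)
    rw [abs_div, abs_div, abs_neg, abs_mul, abs_of_pos hN', abs_of_pos (hupos i),
      abs_of_pos (mul_pos hSpos hN')]
  calc ∑ i, |w i - u i / S| ≤ ∑ i, (|N * w i - u i| / N + u i * |N - S| / (S * N)) :=
        Finset.sum_le_sum fun i _ => h4 i
    _ = (∑ i, |N * w i - u i|) / N + |N - S| / N := by
        rw [Finset.sum_add_distrib, ← Finset.sum_div, ← Finset.sum_div, ← Finset.sum_mul, ← hS]
        field_simp
    _ ≤ Fintype.card κ / N + Fintype.card κ / N := by gcongr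
    _ = _ := by ring

end Grid

/-! ### Histogram approximation on the line -/

section Histogram

/-- The `c`-th of the `b` bins of equal length that partition `(0, 1]`. -/
def unitBin (b : ℕ) (c : Fin b) : Set ℝ := Set.Ioc ((c : ℕ) / b : ℝ) (((c : ℕ) + 1 : ℕ) / b : ℝ)

theorem measurableSet_unitBin (b : ℕ) (c : Fin b) : MeasurableSet (unitBin b c) :=
  measurableSet_Ioc

theorem unitBin_subset (b : ℕ) (c : Fin b) : unitBin b c ⊆ Set.Ioc 0 1 := by
  have hb : (0 : ℝ) < b := by exact_mod_cast c.pos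
  intro x hx
  refine ⟨lt_of_le_of_lt (by positivity) hx.1, hx.2.trans ?_⟩
  rw [div_le_one hb]
  exact_mod_cast c.2

theorem volume_real_unitBin (b : ℕ) (c : Fin b) : volume.real (unitBin b c) = 1 / b := by
  have hb : (0 : ℝ) < b := by exact_mod_cast c.pos
  rw [unitBin, Real.volume_real_Ioc_of_le (by gcongr; simp)]
  push_cast; ring

theorem eq_of_mem_unitBin {b : ℕ} {c c' : Fin b} {x : ℝ} (h : x ∈ unitBin b c)
    (h' : x ∈ unitBin b c') : c = c' := by
  have hb : (0 : ℝ) < b := by exact_mod_cast c.pos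
  have h1 : ((c : ℕ) : ℝ) < ((c' : ℕ) + 1 : ℕ) := (div_lt_div_iff_of_pos_right hb).1
    (h.1.trans_le h'.2)
  have h2 : ((c' : ℕ) : ℝ) < ((c : ℕ) + 1 : ℕ) := (div_lt_div_iff_of_pos_right hb).1
    (h'.1.trans_le h.2)
  have h3 : (c : ℕ) < (c' : ℕ) + 1 := by exact_mod_cast h1
  have h4 : (c' : ℕ) < (c : ℕ) + 1 := by exact_mod_cast h2
  exact Fin.ext (by omega)

theorem sum_setIntegral_unitBin {b : ℕ} (hb : 1 ≤ b) {f : ℝ → ℝ} (hf : Integrable f) :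
    ∑ c : Fin b, ∫ x in unitBin b c, f x = ∫ x in Set.Ioc 0 1, f x := by
  have hb' : (0 : ℝ) < b := by exact_mod_cast hb
  have h := intervalIntegral.sum_integral_adjacent_intervals (f := f) (μ := volume)
    (a := fun c : ℕ => (c : ℝ) / b) (n := b) fun c _ => hf.intervalIntegrable
  simp only [Nat.cast_zero, zero_div, div_self hb'.ne'] at h
  rw [intervalIntegral.integral_of_le zero_le_one, Finset.sum_range] at h
  rw [← h]
  refine Finset.sum_congr rfl fun c _ => ?_
  rw [intervalIntegral.integral_of_le (by gcongr; simp)]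
  rfl

/-- The histogram on `(0, 1]` with `b` bins of equal length that have masses `h`. -/
noncomputable def histogram (b : ℕ) (h : Fin b → ℝ) (x : ℝ) : ℝ :=
  ∑ c, (unitBin b c).indicator (fun _ => b * h c) x

theorem measurable_histogram (b : ℕ) (h : Fin b → ℝ) : Measurable (histogram b h) :=
  Finset.measurable_fun_sum _ fun c _ => measurable_const.indicator (measurableSet_unitBin b c)

theorem integrable_indicator_unitBin {b : ℕ} (c : Fin b) (r : ℝ) :
    Integrable ((unitBin b c).indicator fun _ => r) :=
  (integrable_indicator_iff (measurableSet_unitBin b c)).2 (integrableOn_const (by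
    simp [unitBin]))

theorem integral_indicator_unitBin {b : ℕ} (c : Fin b) (r : ℝ) :
    ∫ x, (unitBin b c).indicator (fun _ => b * r) x = r := by
  have hb : (0 : ℝ) < b := by exact_mod_cast c.pos
  rw [integral_indicator_const _ (measurableSet_unitBin b c), volume_real_unitBin, smul_eq_mul]
  field_simp

theorem integrable_histogram (b : ℕ) (h : Fin b → ℝ) : Integrable (histogram b h) :=
  integrable_finsetSum _ fun c _ => integrable_indicator_unitBin c _

theorem histogram_nonneg {b : ℕ} {h : Fin b → ℝ} (hh : ∀ c, 0 ≤ h c) (x : ℝ) :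
    0 ≤ histogram b h x :=
  Finset.sum_nonneg fun c _ => Set.indicator_nonneg (fun _ _ => mul_nonneg (by simp) (hh c)) x

theorem histogram_of_mem {b : ℕ} (h : Fin b → ℝ) {c : Fin b} {x : ℝ} (hx : x ∈ unitBin b c) :
    histogram b h x = b * h c := by
  rw [histogram, Finset.sum_eq_single c]
  · simp [hx]
  · intro c' _ hc'
    exact Set.indicator_of_notMem (fun hx' => hc' (eq_of_mem_unitBin hx' hx)) _
  · simp

theorem histogram_of_notMem {b : ℕ} (h : Fin b → ℝ) {x : ℝ} (hx : x ∉ Set.Ioc (0 : ℝ) 1) :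
    histogram b h x = 0 :=
  Finset.sum_eq_zero fun c _ =>
    Set.indicator_of_notMem (fun hx' => hx (unitBin_subset b c hx')) _

theorem isPdf_histogram {b : ℕ} {h : Fin b → ℝ} (hh : h ∈ stdSimplex ℝ (Fin b)) :
    IsPdf (histogram b h) := by
  refine ⟨integrable_histogram b h, Eventually.of_forall (histogram_nonneg hh.1), ?_⟩
  simp only [histogram]
  rw [integral_finsetSum _ fun c _ => integrable_indicator_unitBin c _]
  simp only [integral_indicator_unitBin, hh.2]

theorem integral_abs_histogram_sub_le (b : ℕ) (h h' : Fin b → ℝ) :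
    ∫ x, |histogram b h x - histogram b h' x| ≤ ∑ c, |h c - h' c| := by
  have hi : ∀ c, Integrable ((unitBin b c).indicator fun _ => b * |h c - h' c|) :=
    fun c => integrable_indicator_unitBin c _
  calc _ ≤ ∫ x, ∑ c, (unitBin b c).indicator (fun _ => b * |h c - h' c|) x := by
        refine integral_mono ((integrable_histogram b h).sub (integrable_histogram b h')).abs
          (integrable_finsetSum _ fun c _ => hi c) fun x => ?_
        simp only [histogram, ← Finset.sum_sub_distrib]
        refine (Finset.abs_sum_le_sum_abs _ _).trans (Finset.sum_le_sum fun c _ => ?_)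
        by_cases hx : x ∈ unitBin b c
        · simp [hx, ← mul_sub, abs_mul]
        · simp [hx]
    _ = _ := by
        rw [integral_finsetSum _ fun c _ => hi c]
        simp only [integral_indicator_unitBin]

theorem integral_sq_sub_midpoint (a h : ℝ) :
    ∫ x in a..(a + h), (x - (a + h / 2)) ^ 2 = h ^ 3 / 12 := by
  rw [intervalIntegral.integral_comp_sub_right (fun x => x ^ 2), integral_pow]
  norm_num; ring

/-- The mean minimises the quadratic deviation, so it does at least as well as the value at the
midpoint, whose quadratic deviation is at most `K² h³ / 12`. Cauchy–Schwarz passes to the `L¹`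
deviation. -/
theorem intervalIntegral_abs_sub_average_le_of_pos {f : ℝ → ℝ} {K : ℝ} (hK : 0 < K)
    (hf : ∀ x y, |f x - f y| ≤ K * |x - y|) (hc : Continuous f) (a : ℝ) {h : ℝ} (hh : 0 < h) :
    ∫ x in a..(a + h), |f x - (∫ y in a..(a + h), f y) / h| ≤ K * h ^ 2 / √12 := by
  set I := ∫ y in a..(a + h), f y with hI
  set m := I / h with hm
  set z := f (a + h / 2) with hz
  set t := K * h / √12 with ht
  have h12 : (0 : ℝ) < √12 := by positivity
  have hsq : √12 ^ 2 = (12 : ℝ) := Real.sq_sqrt (by norm_num)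
  have htpos : 0 < t := by positivity
  have hle : a ≤ a + h := by linarith
  have ii : ∀ {g : ℝ → ℝ}, Continuous g → IntervalIntegrable g volume a (a + h) :=
    fun hg => hg.intervalIntegrable _ _
  have h1 : ∫ x in a..(a + h), (f x - z) ^ 2 ≤ K ^ 2 * (h ^ 3 / 12) := by
    rw [← integral_sq_sub_midpoint a h, ← intervalIntegral.integral_const_mul]
    refine intervalIntegral.integral_mono_on hle (ii (by fun_prop)) (ii (by fun_prop))
      fun x _ => ?_
    rw [← mul_pow, sq_le_sq, abs_mul, abs_of_pos hK]
    exact hf x _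
  have h2 : ∫ x in a..(a + h), (f x - z) ^ 2
      = (∫ x in a..(a + h), (f x - m) ^ 2) + h * (m - z) ^ 2 := by
    have e : ∀ x, (f x - z) ^ 2 = (f x - m) ^ 2 + (2 * (m - z) * f x + (z ^ 2 - m ^ 2)) := by
      intro x; ring
    simp only [e]
    rw [intervalIntegral.integral_add (ii (by fun_prop)) (ii (by fun_prop)),
      intervalIntegral.integral_add (ii (by fun_prop)) (ii (by fun_prop)),
      intervalIntegral.integral_const_mul, intervalIntegral.integral_const, ← hI]
    have : I = m * h := by rw [hm]; field_simp
    rw [this, smul_eq_mul]; ring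
  -- Cauchy–Schwarz in the form `2 |u| ≤ u² / t + t`, with `t` the bound on the root mean square
  -- deviation; dividing by `t` requires `K > 0`.
  have h3 : ∫ x in a..(a + h), |f x - m| ≤ ∫ x in a..(a + h), ((f x - m) ^ 2 / t + t) / 2 := by
    refine intervalIntegral.integral_mono_on hle (ii (by fun_prop)) (ii (by fun_prop))
      fun x _ => ?_
    rw [le_div_iff₀ two_pos, div_add' _ _ _ htpos.ne', le_div_iff₀ htpos]
    nlinarith [sq_nonneg (|f x - m| - t), sq_abs (f x - m)]
  have h4 : ∫ x in a..(a + h), ((f x - m) ^ 2 / t + t) / 2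
      = ((∫ x in a..(a + h), (f x - m) ^ 2) / t + t * h) / 2 := by
    rw [intervalIntegral.integral_div, intervalIntegral.integral_add (ii (by fun_prop))
      (ii (by fun_prop)), intervalIntegral.integral_div, intervalIntegral.integral_const,
      smul_eq_mul]
    ring
  have h5 : ∫ x in a..(a + h), (f x - m) ^ 2 ≤ t ^ 2 * h := by
    have : t ^ 2 * h = K ^ 2 * (h ^ 3 / 12) := by
      rw [ht, div_pow, hsq]; ring
    rw [this]
    nlinarith [mul_nonneg hh.le (sq_nonneg (m - z))]
  have h6 : (∫ x in a..(a + h), (f x - m) ^ 2) / t ≤ t * h := by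
    rw [div_le_iff₀ htpos]; linarith
  have h7 : K * h ^ 2 / √12 = t * h := by rw [ht]; ring
  rw [h7]
  linarith

theorem LipschitzWith.intervalIntegral_abs_sub_average_le {f : ℝ → ℝ} {K : ℝ≥0}
    (hf : LipschitzWith K f) (a : ℝ) {h : ℝ} (hh : 0 < h) :
    ∫ x in a..(a + h), |f x - (∫ y in a..(a + h), f y) / h| ≤ K * h ^ 2 / √12 := by
  -- The case `K = 0` is reached by using the constant `K + ε` and letting `ε` tend to `0`.
  have key : ∀ ε : ℝ, 0 < ε →
      ∫ x in a..(a + h), |f x - (∫ y in a..(a + h), f y) / h| ≤ (K + ε) * h ^ 2 / √12 := by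
    intro ε hε
    refine intervalIntegral_abs_sub_average_le_of_pos (by positivity) (fun x y => ?_)
      hf.continuous a hh
    have := hf.dist_le_mul x y
    rw [Real.dist_eq, Real.dist_eq] at this
    nlinarith [abs_nonneg (x - y)]
  have hlim : Tendsto (fun ε : ℝ => (K + ε) * h ^ 2 / √12) (𝓝[>] 0) (𝓝 ((K + 0) * h ^ 2 / √12)) :=
    ((by fun_prop : Continuous fun ε : ℝ => (K + ε) * h ^ 2 / √12).tendsto 0).mono_left
      nhdsWithin_le_nhds
  rw [add_zero] at hlim
  exact ge_of_tendsto hlim (eventually_nhdsWithin_of_forall key)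

/-- A set of full Lebesgue measure is dense, and `{0 ≤ f}` is closed. -/
theorem IsPdf.nonneg_of_continuous {f : ℝ → ℝ} (hf : IsPdf f) (hc : Continuous f) (x : ℝ) :
    0 ≤ f x := by
  have hd : Dense {x | 0 ≤ f x} := Measure.dense_of_ae (μ := volume) hf.2.1
  have hcl : IsClosed {x | 0 ≤ f x} := isClosed_le continuous_const hc
  have : x ∈ {x | 0 ≤ f x} := by rw [← hcl.closure_eq]; exact hd x
  exact this

/-- A Lipschitz density carried by the unit interval is close to its histogram. -/
theorem exists_histogram_close {b : ℕ} (hb : 1 ≤ b) {f : ℝ → ℝ} {K : ℝ≥0} (hf : IsPdf f)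
    (hL : LipschitzWith K f) (h1 : ∫ x in Set.Ioc 0 1, f x = 1) :
    ∃ h ∈ stdSimplex ℝ (Fin b), ∫ x, |f x - histogram b h x| ≤ K / (√12 * b) := by
  have hb' : (0 : ℝ) < b := by exact_mod_cast hb
  have hnn := hf.nonneg_of_continuous hL.continuous
  refine ⟨fun c => ∫ x in unitBin b c, f x, ⟨fun c => integral_nonneg hnn, ?_⟩, ?_⟩
  · rw [sum_setIntegral_unitBin hb hf.1, h1]
  set h : Fin b → ℝ := fun c => ∫ x in unitBin b c, f x with hh
  have hi : Integrable fun x => |f x - histogram b h x| :=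
    (hf.1.sub (integrable_histogram b h)).abs
  -- The unit interval already carries the whole mass of `f`.
  have h2 : ∫ x in (Set.Ioc (0 : ℝ) 1)ᶜ, |f x - histogram b h x| = 0 := by
    have h3 := integral_add_compl (measurableSet_Ioc (a := (0 : ℝ)) (b := 1)) hf.1
    rw [hf.2.2, h1] at h3
    have h4 : ∫ x in (Set.Ioc (0 : ℝ) 1)ᶜ, |f x - histogram b h x|
        = ∫ x in (Set.Ioc (0 : ℝ) 1)ᶜ, f x :=
      setIntegral_congr_fun measurableSet_Ioc.compl fun x hx => by
        rw [histogram_of_notMem h hx, sub_zero, abs_of_nonneg (hnn x)]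
    linarith
  rw [← integral_add_compl (measurableSet_Ioc (a := (0 : ℝ)) (b := 1)) hi, h2, add_zero,
    ← sum_setIntegral_unitBin hb hi]
  have h5 : ∀ c : Fin b, ∫ x in unitBin b c, |f x - histogram b h x|
      ≤ K * (1 / b) ^ 2 / √12 := by
    intro c
    have e : ((c : ℕ) + 1 : ℕ) / (b : ℝ) = (c : ℕ) / (b : ℝ) + 1 / b := by push_cast; ring
    have hle : ((c : ℕ) : ℝ) / b ≤ (c : ℕ) / (b : ℝ) + 1 / b := by
      have : (0 : ℝ) ≤ 1 / b := by positivity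
      linarith
    have h6 := hL.intervalIntegral_abs_sub_average_le ((c : ℕ) / b) (h := 1 / b) (by positivity)
    rw [intervalIntegral.integral_of_le hle, intervalIntegral.integral_of_le hle, ← e] at h6
    refine le_trans (le_of_eq ?_) h6
    refine setIntegral_congr_fun (measurableSet_unitBin b c) fun x hx => ?_
    rw [histogram_of_mem h hx]
    simp only [hh, unitBin]
    congr 2
    field_simp
  calc _ ≤ ∑ _c : Fin b, K * (1 / b : ℝ) ^ 2 / √12 := Finset.sum_le_sum fun c _ => h5 c
    _ = _ := by simp; field_simp

end Histogram

/-! ### `L¹` distance of product densities -/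

section Products

/-- Writes a term of the telescoping sum as a single product over coordinates, so that its integral
factorises. -/
theorem mul_prod_lt_mul_prod_gt_eq {d : ℕ} (u a b : Fin d → ℝ) (i : Fin d) :
    u i * (∏ j with j < i, a j) * ∏ j with i < j, b j
      = ∏ j, if j < i then a j else if i < j then b j else u j := by
  rw [Finset.prod_ite, Finset.prod_ite, Finset.filter_filter, Finset.filter_filter]
  have e1 : (Finset.univ.filter fun j : Fin d => ¬ j < i ∧ i < j)
      = Finset.univ.filter fun j => i < j := by
    ext j; simpa using fun h : i < j => h.le
  have e2 : (Finset.univ.filter fun j : Fin d => ¬ j < i ∧ ¬ i < j) = {i} := by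
    ext j; simp [le_antisymm_iff, and_comm]
  rw [e1, e2, Finset.prod_singleton]
  ring

theorem integrable_prod_coord {d : ℕ} {f : Fin d → ℝ → ℝ} (hf : ∀ j, Integrable (f j)) :
    Integrable fun x : Fin d → ℝ => ∏ j, f j (x j) :=
  Integrable.fintype_prod hf

theorem IsPdf.prod_coord {d : ℕ} {f : Fin d → ℝ → ℝ} (hf : ∀ j, IsPdf (f j))
    (h0 : ∀ j x, 0 ≤ f j x) : IsPdf fun x : Fin d → ℝ => ∏ j, f j (x j) := by
  refine ⟨integrable_prod_coord fun j => (hf j).1,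
    Eventually.of_forall fun x => Finset.prod_nonneg fun j _ => h0 j _, ?_⟩
  rw [integral_fintype_prod_volume_eq_prod]
  simp [(hf _).2.2]

/-- The `L¹` distance of product densities is at most the sum of those of their factors. -/
theorem integral_abs_prod_sub_prod_le {d : ℕ} {f g : Fin d → ℝ → ℝ} (hf : ∀ j, IsPdf (f j))
    (hg : ∀ j, IsPdf (g j)) (hf0 : ∀ j x, 0 ≤ f j x) (hg0 : ∀ j x, 0 ≤ g j x) :
    ∫ x : Fin d → ℝ, |∏ j, f j (x j) - ∏ j, g j (x j)| ≤ ∑ j, ∫ x, |f j x - g j x| := by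
  -- Telescoping one coordinate at a time: the `i`-th term has factors `f` before `i`, `g` after
  -- `i`, and the difference at `i`. All other factors integrate to one.
  let φ : Fin d → Fin d → ℝ → ℝ := fun i j x =>
    if j < i then f j x else if i < j then g j x else |f j x - g j x|
  have hφ : ∀ i j, Integrable (φ i j) := by
    intro i j
    by_cases h1 : j < i
    · simpa only [φ, h1, if_true] using (hf j).1
    · by_cases h2 : i < j
      · simpa only [φ, h1, h2, if_true, if_false] using (hg j).1
      · have h : Integrable fun x => |f j x - g j x| := ((hf j).1.sub (hg j).1).abs
        simpa only [φ, h1, h2, if_false] using h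
  have hint : ∀ i, ∫ x : Fin d → ℝ, ∏ j, φ i j (x j) = ∫ x, |f i x - g i x| := by
    intro i
    rw [integral_fintype_prod_volume_eq_prod, Finset.prod_eq_single i]
    · simp [φ]
    · intro j _ hj
      rcases lt_or_gt_of_ne hj with h | h
      · simp only [φ, h, if_true]; exact (hf j).2.2
      · simp only [φ, h, h.not_gt, if_true, if_false]; exact (hg j).2.2
    · simp
  calc _ ≤ ∫ x : Fin d → ℝ, ∑ i, ∏ j, φ i j (x j) := by
        refine integral_mono ((integrable_prod_coord fun j => (hf j).1).sub
          (integrable_prod_coord fun j => (hg j).1)).abs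
          (integrable_finsetSum _ fun i _ => integrable_prod_coord (hφ i)) fun x => ?_
        have h := Finset.prod_add_ordered Finset.univ (fun j => g j (x j))
          (fun j => f j (x j) - g j (x j))
        simp only [add_sub_cancel] at h
        dsimp only
        rw [h, add_sub_cancel_left]
        refine (Finset.abs_sum_le_sum_abs _ _).trans (Finset.sum_le_sum fun i _ => ?_)
        simp only [φ]
        rw [← mul_prod_lt_mul_prod_gt_eq (fun j => |f j (x j) - g j (x j)|)
          (fun j => f j (x j)) (fun j => g j (x j)) i, abs_mul, abs_mul,
          abs_of_nonneg (Finset.prod_nonneg fun j _ => hf0 j (x j)),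
          abs_of_nonneg (Finset.prod_nonneg fun j _ => hg0 j (x j))]
    _ = _ := by
        rw [integral_finsetSum _ fun i _ => integrable_prod_coord (hφ i)]
        simp only [hint]

end Products

/-! ### Finite mixtures -/

section Mixtures

/-- Split `v F - v' G = v (F - G) + (v - v') G` and use that each `G i` has `L¹` norm one. -/
theorem integral_abs_mixture_sub_le {α κ : Type*} [MeasureSpace α] [Fintype κ] {v v' : κ → ℝ}
    (hv : ∀ i, 0 ≤ v i) {F G : κ → α → ℝ} (hF : ∀ i, Integrable (F i)) (hG : ∀ i, IsPdf (G i)) :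
    ∫ x, |∑ i, v i * F i x - ∑ i, v' i * G i x|
      ≤ (∑ i, v i * ∫ x, |F i x - G i x|) + ∑ i, |v i - v' i| := by
  have hFG : ∀ i, Integrable fun x => |F i x - G i x| := fun i => ((hF i).sub (hG i).1).abs
  have hGa : ∀ i, ∫ x, |G i x| = 1 := fun i => by
    rw [← (hG i).2.2]
    exact integral_congr_ae ((hG i).2.1.mono fun x hx => abs_of_nonneg hx)
  have hi : ∀ i, Integrable fun x => v i * |F i x - G i x| + |v i - v' i| * |G i x| :=
    fun i => ((hFG i).const_mul _).add ((hG i).1.abs.const_mul _)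
  calc _ ≤ ∫ x, ∑ i, (v i * |F i x - G i x| + |v i - v' i| * |G i x|) := by
        refine integral_mono
          ((integrable_finsetSum _ fun i _ => (hF i).const_mul _).sub
            (integrable_finsetSum _ fun i _ => (hG i).1.const_mul _)).abs
          (integrable_finsetSum _ fun i _ => hi i) fun x => ?_
        dsimp only
        rw [← Finset.sum_sub_distrib]
        refine (Finset.abs_sum_le_sum_abs _ _).trans (Finset.sum_le_sum fun i _ => ?_)
        have e : v i * F i x - v' i * G i x
            = v i * (F i x - G i x) + (v i - v' i) * G i x := by ring
        rw [e]
        refine (abs_add_le _ _).trans ?_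
        rw [abs_mul, abs_mul, abs_of_nonneg (hv i)]
    _ = ∑ i, (v i * (∫ x, |F i x - G i x|) + |v i - v' i|) := by
        rw [integral_finsetSum _ fun i _ => hi i]
        refine Finset.sum_congr rfl fun i _ => ?_
        rw [integral_add ((hFG i).const_mul _) ((hG i).1.abs.const_mul _),
          integral_const_mul, integral_const_mul, hGa, mul_one]
    _ = _ := Finset.sum_add_distrib

theorem IsPdf.mixture {α κ : Type*} [MeasureSpace α] [Fintype κ] {v : κ → ℝ}
    (hv : v ∈ stdSimplex ℝ κ) {F : κ → α → ℝ} (hF : ∀ i, IsPdf (F i)) :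
    IsPdf fun x => ∑ i, v i * F i x := by
  refine ⟨integrable_finsetSum _ fun i _ => (hF i).1.const_mul _, ?_, ?_⟩
  · filter_upwards [ae_all_iff.2 fun i => (hF i).2.1] with x hx
    exact Finset.sum_nonneg fun i _ => mul_nonneg (hv.1 i) (hx i)
  · rw [integral_finsetSum _ fun i _ => (hF i).1.const_mul _]
    simp [integral_const_mul, (hF _).2.2, hv.2]

/-- The mixture with weights `v` of the products of the histograms with bin masses `h i j`. -/
noncomputable def histogramMixture {κ : Type*} [Fintype κ] {d b : ℕ} (v : κ → ℝ)
    (h : κ → Fin d → Fin b → ℝ) (x : Fin d → ℝ) : ℝ :=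
  ∑ i, v i * ∏ j, histogram b (h i j) (x j)

theorem measurable_histogramMixture {κ : Type*} [Fintype κ] {d b : ℕ} (v : κ → ℝ)
    (h : κ → Fin d → Fin b → ℝ) : Measurable (histogramMixture v h) :=
  Finset.measurable_fun_sum _ fun i _ => Measurable.const_mul
    (Finset.measurable_fun_prod _ fun j _ =>
      (measurable_histogram b (h i j)).comp (measurable_pi_apply j)) _

theorem isPdf_prod_histogram {d b : ℕ} {h : Fin d → Fin b → ℝ}
    (hh : ∀ j, h j ∈ stdSimplex ℝ (Fin b)) :
    IsPdf fun x : Fin d → ℝ => ∏ j, histogram b (h j) (x j) :=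
  IsPdf.prod_coord (fun j => isPdf_histogram (hh j)) fun j => histogram_nonneg (hh j).1

theorem histogramMixture_mem_cubePdfs {κ : Type*} [Fintype κ] {d b : ℕ} {v : κ → ℝ}
    (hv : v ∈ stdSimplex ℝ κ) {h : κ → Fin d → Fin b → ℝ}
    (hh : ∀ i j, h i j ∈ stdSimplex ℝ (Fin b)) : histogramMixture v h ∈ cubePdfs d := by
  refine ⟨IsPdf.mixture hv fun i => isPdf_prod_histogram (hh i), Eventually.of_forall fun x hx => ?_⟩
  have : ∃ j, x j ∉ Set.Ioc (0 : ℝ) 1 := by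
    by_contra! hcon
    exact hx ⟨fun j => (hcon j).1.le, fun j => (hcon j).2⟩
  obtain ⟨j, hj⟩ := this
  refine Finset.sum_eq_zero fun i _ => ?_
  rw [Finset.prod_eq_zero (Finset.mem_univ j) (histogram_of_notMem _ hj), mul_zero]

end Mixtures

/-! ### Approximation of an NL-class by the net -/

section Approximation

theorem card_pnat_Iic (k : ℕ+) : Fintype.card (Finset.Iic k) = k := by
  rw [Fintype.card_coe, Finset.Iic_eq_Icc, PNat.card_Icc]
  simp

/-- If a product density vanishes outside the cube, then its factors are carried by the unit
interval. -/
theorem setIntegral_eq_one_of_prod_vanishes {d : ℕ} {f : Fin d → ℝ → ℝ} (hf : ∀ j, IsPdf (f j))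
    (h0 : ∀ j x, 0 ≤ f j x)
    (hv : ∀ᵐ x : Fin d → ℝ, x ∉ Set.Icc (0 : Fin d → ℝ) 1 → ∏ j, f j (x j) = 0) (j : Fin d) :
    ∫ x in Set.Ioc 0 1, f j x = 1 := by
  have hprod : ∏ j, ∫ x in Set.Icc 0 1, f j x = 1 := by
    have h1 : ∀ j, ∫ x in Set.Icc 0 1, f j x = ∫ x, (Set.Icc 0 1).indicator (f j) x :=
      fun j => (integral_indicator measurableSet_Icc).symm
    simp only [h1]
    rw [← integral_fintype_prod_volume_eq_prod]
    refine Eq.trans ?_ (IsPdf.prod_coord hf h0).2.2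
    refine integral_congr_ae (hv.mono fun x hx => ?_)
    dsimp only
    by_cases hxc : x ∈ Set.Icc (0 : Fin d → ℝ) 1
    · exact Finset.prod_congr rfl fun j _ => Set.indicator_of_mem
        (s := Set.Icc (0 : ℝ) 1) ⟨hxc.1 j, hxc.2 j⟩ _
    · rw [hx hxc]
      have : ∃ j, x j ∉ Set.Icc (0 : ℝ) 1 := by
        by_contra! hcon
        exact hxc ⟨fun j => (hcon j).1, fun j => (hcon j).2⟩
      obtain ⟨j, hj⟩ := this
      exact Finset.prod_eq_zero (Finset.mem_univ j) (Set.indicator_of_notMem hj _)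
  have hle : ∀ j, ∫ x in Set.Icc 0 1, f j x ≤ 1 := fun j => by
    rw [← (hf j).2.2]
    exact setIntegral_le_integral (hf j).1 (hf j).2.1
  have hnn : ∀ j, 0 ≤ ∫ x in Set.Icc 0 1, f j x := fun j => integral_nonneg (h0 j)
  rw [← integral_Icc_eq_integral_Ioc]
  -- Numbers in `[0, 1]` whose product is one are all equal to one.
  refine le_antisymm (hle j) ?_
  refine hprod.symm.le.trans ?_
  rw [← Finset.mul_prod_erase _ _ (Finset.mem_univ j)]
  exact mul_le_of_le_one_right (hnn j) (Finset.prod_le_one (fun i _ => hnn i) fun i _ => hle i)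

/-- Truncating `p` to `S` loses mass `1 - s`, and rescaling `S` back to mass one moves it by `1 - s`
again. -/
theorem integral_abs_sub_div_le {α : Type*} [MeasureSpace α] {p S : α → ℝ} (hp : IsPdf p)
    (hS : Integrable S) (h0 : 0 ≤ᵐ[volume] S) (hle : S ≤ᵐ[volume] p) {s : ℝ} (hs : 0 < s)
    (hs1 : s ≤ 1) (hint : ∫ x, S x = s) :
    ∫ x, |p x - S x / s| ≤ 2 * (1 - s) := by
  refine (integral_abs_sub_triangle hp.1 hS (hS.div_const s)).trans ?_
  have h1 : ∫ x, |p x - S x| = 1 - s := by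
    rw [← hint, ← hp.2.2, ← integral_sub hp.1 hS]
    exact integral_congr_ae (hle.mono fun x hx => abs_of_nonneg (sub_nonneg.2 hx))
  have h2 : ∫ x, |S x - S x / s| = 1 - s := by
    have : ∫ x, |S x - S x / s| = ∫ x, S x * ((1 - s) / s) := by
      refine integral_congr_ae (h0.mono fun x hx => ?_)
      have hx' : 0 ≤ S x := hx
      have e : S x - S x / s = -(S x * ((1 - s) / s)) := by field_simp; ring
      dsimp only
      rw [e, abs_neg, abs_of_nonneg (mul_nonneg hx' (div_nonneg (by linarith) hs.le))]
    rw [this, integral_mul_const, hint]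
    field_simp
  linarith

/-- Densities on the cube in an NL-class are close to mixtures of products of histograms whose
parameters lie on a grid. -/
theorem exists_grid_histogramMixture_close {d b : ℕ} (hb : 1 ≤ b) (k : ℕ+) {W L : ℕ+ → ℝ}
    (hWL : IsNLParam W L) {p : (Fin d → ℝ) → ℝ} (hp : p ∈ cubePdfs d ∩ nlClass d W L)
    {N : ℕ} (hN : 0 < N) :
    ∃ (a : Finset.Iic k → Fin (N + 1)) (c : Finset.Iic k → Fin d → Fin b → Fin (N + 1)),
      ∫ x, |p x - histogramMixture (gridWeight a) (fun i j => gridWeight (c i j)) x|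
        ≤ 2 * W k + (d * (L k / (√12 * b) + 2 * b / N) + 2 * k / N) := by
  obtain ⟨⟨hpdf, hcube⟩, -, w, l, ⟨hw0, hw1, hws, q, hq, hqs⟩, hlw⟩ := hp
  have : NeZero b := ⟨by omega⟩
  have : Nonempty (Finset.Iic k) := ⟨⟨k, by simp⟩⟩
  have hq0 : ∀ i j x, 0 ≤ q i j x := fun i j =>
    (hq i j).1.nonneg_of_continuous (hq i j).2.continuous
  have hF0 : ∀ i (x : Fin d → ℝ), 0 ≤ w i * ∏ j, q i j (x j) := fun i x =>
    mul_nonneg (hw0 i) (Finset.prod_nonneg fun j _ => hq0 i j _)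
  have hFpdf : ∀ i, IsPdf fun x : Fin d → ℝ => ∏ j, q i j (x j) := fun i =>
    IsPdf.prod_coord (fun j => (hq i j).1) (hq0 i)
  set s := ∑ i ∈ Finset.Iic k, w i with hs
  -- The condition `w 1 > 0` makes the truncated mixture normalisable for every `k`.
  have hspos : 0 < s := lt_of_lt_of_le hw1
    (Finset.single_le_sum (fun i _ => hw0 i) (by simp))
  have hs1 : s ≤ 1 := sum_le_hasSum _ (fun i _ => hw0 i) hws
  have htail : 1 - s ≤ W k := by
    have h1 := hws.summable.sum_add_tsum_compl (s := Finset.Iic k)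
    have e : ((Finset.Iic k : Finset ℕ+) : Set ℕ+)ᶜ = Set.Ioi k := by
      ext i; simp
    rw [e, hws.tsum_eq] at h1
    have := (hlw k).2
    linarith
  let S : (Fin d → ℝ) → ℝ := fun x => ∑ i ∈ Finset.Iic k, w i * ∏ j, q i j (x j)
  have hS : Integrable S := integrable_finsetSum _ fun i _ => (hFpdf i).1.const_mul _
  have hSint : ∫ x, S x = s := by
    rw [integral_finsetSum _ fun i _ => (hFpdf i).1.const_mul _]
    simp [integral_const_mul, (hFpdf _).2.2, hs]
  have htrunc := integral_abs_sub_div_le hpdf hS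
    (Eventually.of_forall fun x => Finset.sum_nonneg fun i _ => hF0 i x)
    (hqs.mono fun x hx => sum_le_hasSum _ (fun i _ => hF0 i x) hx) hspos hs1 hSint
  let v : Finset.Iic k → ℝ := fun i => w i / s
  have hv : v ∈ stdSimplex ℝ (Finset.Iic k) := by
    refine ⟨fun i => div_nonneg (hw0 _) hspos.le, ?_⟩
    simp only [v]
    rw [← Finset.sum_div, Finset.sum_coe_sort (Finset.Iic k) w, div_self hspos.ne']
  have hSv : ∀ x, S x / s = ∑ i, v i * ∏ j, q i j (x j) := by
    intro x
    simp only [v, S]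
    rw [← Finset.sum_coe_sort, Finset.sum_div]
    exact Finset.sum_congr rfl fun i _ => by ring
  -- All terms are non-negative, so a component of positive weight is dominated by a multiple of `p`
  -- and vanishes off the cube. Components of weight zero may live anywhere; they receive an
  -- arbitrary histogram below.
  have hvan : ∀ i, w i ≠ 0 → ∀ᵐ x : Fin d → ℝ, x ∉ Set.Icc (0 : Fin d → ℝ) 1 →
      ∏ j, q i j (x j) = 0 := by
    intro i hi
    filter_upwards [hcube, hqs] with x h1 h2 hx
    have h3 := le_hasSum h2 i fun i' _ => hF0 i' x
    rw [h1 hx] at h3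
    exact (mul_eq_zero.1 (le_antisymm h3 (hF0 i x))).resolve_left hi
  obtain ⟨a, ha⟩ := exists_gridWeight_close hv hN
  have hbins : ∀ (i : Finset.Iic k) (j : Fin d), ∃ c : Fin b → Fin (N + 1),
      w i ≠ 0 → ∫ x, |q i j x - histogram b (gridWeight c) x|
        ≤ L k / (√12 * b) + 2 * b / N := by
    intro i j
    by_cases hi : w i = 0
    · exact ⟨fun _ => 0, fun h => absurd hi h⟩
    obtain ⟨h, hh, hclose⟩ := exists_histogram_close hb (hq i j).1 (hq i j).2
      (setIntegral_eq_one_of_prod_vanishes (fun j => (hq i j).1) (hq0 i) (hvan i hi) j)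
    obtain ⟨c, hc⟩ := exists_gridWeight_close hh hN
    refine ⟨c, fun _ => (integral_abs_sub_triangle (hq i j).1.1 (integrable_histogram b h)
      (integrable_histogram b _)).trans (add_le_add (hclose.trans ?_)
        ((integral_abs_histogram_sub_le b _ _).trans ?_))⟩
    · have : (l i : ℝ) ≤ L k :=
        (hlw i).1.trans (hWL.2.2.2.2 (Finset.mem_Iic.1 i.2))
      gcongr
    · simpa using hc
  choose c hc using hbins
  refine ⟨a, c, ?_⟩
  have hG : ∀ i : Finset.Iic k, IsPdf fun x : Fin d → ℝ =>
      ∏ j, histogram b (gridWeight (c i j)) (x j) := fun i =>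
    isPdf_prod_histogram fun j => gridWeight_mem_stdSimplex _
  have hmix := integral_abs_mixture_sub_le (v' := gridWeight a) hv.1
    (F := fun (i : Finset.Iic k) x => ∏ j, q i j (x j)) (fun i => (hFpdf i).1) hG
  have hterm : ∀ i : Finset.Iic k, v i * ∫ x : Fin d → ℝ,
      |∏ j, q i j (x j) - ∏ j, histogram b (gridWeight (c i j)) (x j)|
        ≤ v i * (d * (L k / (√12 * b) + 2 * b / N)) := by
    intro i
    by_cases hi : w i = 0
    · simp [v, hi]
    refine mul_le_mul_of_nonneg_left ?_ (hv.1 i)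
    refine (integral_abs_prod_sub_prod_le (fun j => (hq i j).1)
      (fun j => isPdf_histogram (gridWeight_mem_stdSimplex _)) (hq0 i)
      fun j => histogram_nonneg (gridWeight_mem_stdSimplex _).1).trans ?_
    calc _ ≤ ∑ _j : Fin d, (L k / (√12 * b) + 2 * b / N) :=
          Finset.sum_le_sum fun j _ => hc i j hi
      _ = _ := by rw [Finset.sum_const, Finset.card_univ, Fintype.card_fin, nsmul_eq_mul]
  have hsum : ∑ i : Finset.Iic k, v i * ∫ x : Fin d → ℝ,
      |∏ j, q i j (x j) - ∏ j, histogram b (gridWeight (c i j)) (x j)|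
        ≤ d * (L k / (√12 * b) + 2 * b / N) := by
    refine (Finset.sum_le_sum fun i _ => hterm i).trans (le_of_eq ?_)
    rw [← Finset.sum_mul, hv.2, one_mul]
  have hcard : (Fintype.card (Finset.Iic k) : ℝ) = (k : ℕ) := by
    rw [card_pnat_Iic]
  rw [hcard] at ha
  have htri := integral_abs_sub_triangle hpdf.1 (hS.div_const s)
    (histogramMixture_mem_cubePdfs (gridWeight_mem_stdSimplex a)
      fun i j => gridWeight_mem_stdSimplex (c i j)).1.1
  have hmix' : ∫ x, |S x / s - histogramMixture (gridWeight a) (fun i j => gridWeight (c i j)) x|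
      ≤ d * (L k / (√12 * b) + 2 * b / N) + 2 * k / N := by
    simp only [hSv]
    exact hmix.trans (add_le_add hsum ha)
  linarith

end Approximation

/-! ### Constants and the main theorem -/

/-- Used with `D = b d k`, `Λ = log (4 b d k n)` and `C` the size of the net. Subadditivity of the
square root gives both terms the constant `4`; the rounding error `4 / n` takes the remaining `3` of
the first term. -/
theorem stochastic_error_bound {δ D Λ n C : ℝ} (hn : 1 ≤ n) (hδ : 0 < δ) (hD : 1 ≤ D)
    (hΛ : 1 ≤ Λ) (hC : 1 ≤ C) (hCD : Real.log C ≤ 2 * D * Λ) (hδ1 : δ ≤ 1) :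
    4 / n + 4 * √(Real.log (3 * C ^ 2 / δ) / (2 * n))
      ≤ 7 * √(2 * D * Λ / n) + 7 * √(Real.log (3 / δ) / (2 * n)) := by
  have hn0 : 0 < n := by linarith
  have h3 : 0 ≤ Real.log (3 / δ) := Real.log_nonneg (by rw [le_div_iff₀ hδ]; linarith)
  have e : Real.log (3 * C ^ 2 / δ) / (2 * n)
      = Real.log C / n + Real.log (3 / δ) / (2 * n) := by
    have : 3 * C ^ 2 / δ = C ^ 2 * (3 / δ) := by ring
    rw [this, Real.log_mul (by positivity) (by positivity), Real.log_pow]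
    push_cast
    field_simp
  have h4 : √(Real.log (3 * C ^ 2 / δ) / (2 * n))
      ≤ √(2 * D * Λ / n) + √(Real.log (3 / δ) / (2 * n)) := by
    rw [e]
    refine Real.sqrt_le_iff.2 ⟨by positivity, ?_⟩
    have h5 : 0 ≤ 2 * D * Λ / n := by positivity
    have h6 : 0 ≤ Real.log (3 / δ) / (2 * n) := by positivity
    have h7 : Real.log C / n ≤ 2 * D * Λ / n := by gcongr
    have h8 := mul_nonneg (Real.sqrt_nonneg (2 * D * Λ / n))
      (Real.sqrt_nonneg (Real.log (3 / δ) / (2 * n)))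
    rw [add_sq, Real.sq_sqrt h5, Real.sq_sqrt h6]
    linarith
  have h5 : 4 / n ≤ 3 * √(2 * D * Λ / n) := by
    have h6 : 4 / (3 * n) ≤ √(2 * D * Λ / n) := by
      refine Real.le_sqrt_of_sq_le ?_
      rw [div_pow, div_le_div_iff₀ (by positivity) hn0]
      have h7 : 1 ≤ D * Λ := one_le_mul_of_one_le_of_one_le hD hΛ
      have h8 : n ≤ n ^ 2 := by nlinarith
      nlinarith [mul_le_mul_of_nonneg_left h7 (sq_nonneg n)]
    have : 4 / n = 3 * (4 / (3 * n)) := by field_simp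
    linarith
  have h6 : 0 ≤ √(Real.log (3 / δ) / (2 * n)) := Real.sqrt_nonneg _
  linarith

/-- The net has `k` weights and `k d b` bin masses, hence at most `2 b d k` grid parameters. -/
theorem card_grid_le {d b k M : ℕ} (hd : 1 ≤ d) (hb : 1 ≤ b) (hM : 1 ≤ M) :
    M ^ k * ((M ^ b) ^ d) ^ k ≤ M ^ (2 * (b * d * k)) := by
  rw [← pow_mul, ← pow_mul, ← pow_add]
  refine Nat.pow_le_pow_right hM ?_
  have : 1 * k ≤ b * d * k := Nat.mul_le_mul_right k (Nat.mul_pos hb hd)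
  linarith

theorem theorem3 (d b n : ℕ) (hd : 1 ≤ d) (hb : 1 ≤ b) (hn : 1 ≤ n) (k : ℕ+)
    (δ : ℝ) (hδ0 : 0 < δ) (hδ1 : δ ≤ 1) :
    ∃ V : (Fin n → Fin d → ℝ) → (Fin d → ℝ) → ℝ, IsCubeEstimator V ∧
      ∀ W L : ℕ+ → ℝ, IsNLParam W L →
      ∀ p ∈ cubePdfs d ∩ nlClass d W L,
      ∀ (Ω : Type*) [MeasurableSpace Ω] (P : Measure Ω) [IsProbabilityMeasure P]
        (X : Fin n → Ω → Fin d → ℝ), IsIIDSample P X p →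
        P {ω | √3 * d / (2 * b) * L k + 6 * W k
              + 7 * √(2 * b * d * k * Real.log (4 * b * d * k * n) / n)
              + 7 * √(Real.log (3 / δ) / (2 * n))
            < ∫ y, |p y - V (fun i => X i ω) y|} < ENNReal.ofReal δ := by
  classical
  set K : ℕ := (k : ℕ) with hK
  have hKpos : 1 ≤ K := k.pos
  set Q : ℕ := b * d * K with hQ
  have hQpos : 1 ≤ Q := Nat.mul_pos (Nat.mul_pos hb hd) hKpos
  have hQn : 1 ≤ Q * n := Nat.mul_pos hQpos hn
  -- Each parameter takes `N + 1 = 4 b d k n` values, the argument of the logarithm in the bound;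
  -- still `N ≥ 3 b d k n`, which controls the rounding error.
  obtain ⟨N, hN⟩ : ∃ N, 4 * (Q * n) = N + 1 := ⟨4 * (Q * n) - 1, by omega⟩
  have hNpos : 0 < N := by omega
  have : NeZero b := ⟨by omega⟩
  have : Nonempty (Finset.Iic k) := ⟨⟨k, by simp⟩⟩
  let Θ := (Finset.Iic k → Fin (N + 1)) × (Finset.Iic k → Fin d → Fin b → Fin (N + 1))
  let g : Θ → (Fin d → ℝ) → ℝ := fun θ =>
    histogramMixture (gridWeight θ.1) fun i j => gridWeight (θ.2 i j)
  obtain ⟨V, hV, hVb⟩ := exists_cubeEstimator_of_finite hn g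
    (fun θ => histogramMixture_mem_cubePdfs (gridWeight_mem_stdSimplex _)
      fun i j => gridWeight_mem_stdSimplex _)
    fun θ => measurable_histogramMixture _ _
  refine ⟨V, hV, fun W L hWL p hp Ω _ P _ X hX => ?_⟩
  obtain ⟨a, c, hclose⟩ := exists_grid_histogramMixture_close hb k hWL hp hNpos
  set C : ℝ := (Fintype.card Θ : ℝ) with hC
  have hC1 : 1 ≤ C := by
    have : 0 < Fintype.card Θ := Fintype.card_pos
    rw [hC]
    exact_mod_cast this
  have hn' : (1 : ℝ) ≤ n := by exact_mod_cast hn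
  have hn0 : (0 : ℝ) < n := by linarith
  have hb' : (0 : ℝ) < b := by exact_mod_cast hb
  have hN' : (0 : ℝ) < N := by exact_mod_cast hNpos
  have hQ' : (1 : ℝ) ≤ Q := by exact_mod_cast hQpos
  have hQe : (Q : ℝ) = b * d * K := by simp [hQ]
  have hM : (4 * b * d * K * n : ℝ) = ((N + 1 : ℕ) : ℝ) := by
    rw [← hN]; push_cast; rw [hQe]; ring
  set Λ := Real.log (4 * b * d * K * n) with hΛ
  have hΛ1 : 1 ≤ Λ := by
    rw [hΛ, hM, Real.le_log_iff_exp_le (by positivity), ← hN]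
    have h1 : (1 : ℝ) ≤ (Q * n : ℕ) := by exact_mod_cast hQn
    have h2 := Real.exp_one_lt_d9
    push_cast at h1 ⊢
    linarith
  have hCΛ : Real.log C ≤ 2 * Q * Λ := by
    have h1 : Fintype.card Θ ≤ (N + 1) ^ (2 * Q) := by
      have h2 : Fintype.card Θ = (N + 1) ^ K * (((N + 1) ^ b) ^ d) ^ K := by
        simp only [Θ, Fintype.card_prod, Fintype.card_fun, Fintype.card_fin, card_pnat_Iic, hK]
      rw [h2]
      exact card_grid_le hd hb (by omega)
    have h2 : C ≤ ((N + 1 : ℕ) : ℝ) ^ (2 * Q) := by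
      rw [hC]
      exact_mod_cast h1
    refine (Real.log_le_log (by linarith) h2).trans (le_of_eq ?_)
    rw [Real.log_pow, hΛ, hM]
    push_cast
    ring
  -- With this `t` the union bound over `C²` pairs equals `2 δ / 3`, which leaves room for the
  -- strict inequality.
  set t := √(Real.log (3 * C ^ 2 / δ) / (2 * n)) with ht
  have hlog : 0 ≤ Real.log (3 * C ^ 2 / δ) := by
    refine Real.log_nonneg ?_
    rw [le_div_iff₀ hδ0]
    nlinarith
  have htail : C ^ 2 * (2 * Real.exp (-(2 * n * t ^ 2))) = 2 / 3 * δ := by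
    rw [ht, Real.sq_sqrt (by positivity), mul_div_cancel₀ _ (by positivity), Real.exp_neg,
      Real.exp_log (by positivity)]
    field_simp
  have hstoch := stochastic_error_bound hn' hδ0 hQ' hΛ1 hC1 hCΛ hδ1
  -- From `d b + k ≤ 2 Q` and `N ≥ 3 Q n`: `6 · 2 Q / (3 Q n) = 4 / n`.
  have hnet : 3 * (d * (2 * b / N) + 2 * K / N) ≤ 4 / (n : ℝ) := by
    have h1 : (d * b + K : ℝ) ≤ 2 * Q := by
      have h2 : d * b * 1 ≤ d * b * K := Nat.mul_le_mul_left _ hKpos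
      have h3 : 1 * K ≤ b * d * K := Nat.mul_le_mul_right K (Nat.mul_pos hb hd)
      have h4 : d * b * K = b * d * K := by ring
      have : d * b + K ≤ 2 * Q := by omega
      exact_mod_cast this
    have h2 : (3 * (Q * n) : ℝ) ≤ N := by
      have : 3 * (Q * n) ≤ N := by omega
      exact_mod_cast this
    have e : 3 * (d * (2 * b / N) + 2 * K / N) = 6 * (d * b + K : ℝ) / N := by ring
    rw [e, div_le_div_iff₀ hN' hn0]
    nlinarith
  have hbias : 3 * (d * (L k / (√12 * b))) = √3 * d / (2 * b) * L k := by
    have h12 : √12 = 2 * √3 := by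
      rw [show (12 : ℝ) = 2 ^ 2 * 3 by norm_num, Real.sqrt_mul (by norm_num),
        Real.sqrt_sq (by norm_num)]
    have h3 : √3 ≠ 0 := by positivity
    have h33 : √3 * √3 = (3 : ℝ) := Real.mul_self_sqrt (by norm_num)
    rw [h12]
    field_simp
    linear_combination (-(L k)) * h33
  have hthr : 3 * (∫ y, |p y - g (a, c) y|) + 4 * t ≤ √3 * d / (2 * b) * L k + 6 * W k
      + 7 * √(2 * b * d * K * Λ / n) + 7 * √(Real.log (3 / δ) / (2 * n)) := by
    have e : (2 * b * d * K * Λ / n : ℝ) = 2 * Q * Λ / n := by rw [hQe]; ring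
    rw [e]
    have hclose' : ∫ y, |p y - g (a, c) y|
        ≤ 2 * W k + (d * (L k / (√12 * b) + 2 * b / N) + 2 * K / N) := hclose
    have e2 : 3 * (2 * W k + (d * (L k / (√12 * b) + 2 * b / N) + 2 * K / N))
        = 6 * W k + 3 * (d * (L k / (√12 * b))) + 3 * (d * (2 * b / N) + 2 * K / N) := by ring
    linarith
  have hprob := hVb p hp.1.1 (a, c) t (Real.sqrt_nonneg _) Ω P X hX
  rw [htail] at hprob
  rw [ENNReal.lt_ofReal_iff_toReal_lt (measure_ne_top _ _)]
  refine lt_of_le_of_lt (le_trans (measureReal_mono fun ω hω => ?_) hprob) (by linarith)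
  exact lt_of_le_of_lt hthr hω
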